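/- Let $X$ and $Y$ be real Hilbert spaces, each identified with its dual, and let $Z=X\times Y$ carry the inner product $\langle (x_1,y_1),(x_2,y_2)\rangle_Z=\langle x_1,x_2\rangle_X+\langle y_1,y_2\rangle_Y$. Let $F:X\to\mathbb{R}\cup\{\infty\}$ and $G:Y\to\mathbb{R}\cup\{\infty\}$ be proper, convex and lower semicontinuous, and let $A:X\to Y$ be a bounded linear operator with adjoint $A^*$. Write $\operatorname{dom}F=\{x: F(x)<\infty\}$; let $\partial F(x)=\{\xi\in X:\langle \xi,x'-x\rangle_X\le F(x')-F(x)\ \text{for all }x'\in X\}$ for $x\in\operatorname{dom}F$ and $\partial F(x)=\emptyset$ otherwise, $G^*(y)=\sup_{v\in Y}\big(\langle y,v\rangle_Y-G(v)\big)$, and $\mathrm{prox}_H(x)=\operatorname{argmin}_{z}\big(\tfrac12\|z-x\|^2+H(z)\big)$. Assume that (i) the problem $\min_{x\in X}F(x)+G(Ax)$ admits a solution; (ii) there exists $x_0\in\operatorname{dom}F\cap\operatorname{dom}(G\circ A)$ such that $Ax_0$ is an interior point of $\operatorname{dom}G$. Let $\sigma,\tau>0$ satisfy $\sigma\tau\|A\|^2<1$.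 Then, for every starting point $(x^0,y^0)\in Z$, the primal-dual extragradient (Chambolle-Pock) iteration $$x^{k+1}=\mathrm{prox}_{\tau F}(x^k-\tau A^*y^k),\qquad \bar x^{k+1}=2x^{k+1}-x^k,\qquad y^{k+1}=\mathrm{prox}_{\sigma G^*}(y^k+\sigma A\bar x^{k+1})$$ defines a unique sequence $\{(x^k,y^k)\}_{k\in\mathbb{N}}$, and this sequence converges weakly in $Z$ to a pair $(\bar x,\bar y)$ satisfying the Fenchel extremality conditions $$-A^*\bar y\in\partial F(\bar x),\qquad \bar y\in\partial G(A\bar x)$$ (equivalently, $-A^*\bar y\in\partial F(\bar x)$ and $A\bar x\in\partial G^*(\bar y)$). -/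

import Mathlib

open Filter Topology

noncomputable section

namespace ConvexOpt

/-- The effective domain of an extended-real-valued functional. -/
def effDom {E : Type*} (F : E → EReal) : Set E := {x | F x < ⊤}

/-- Proper functionals with values in `ℝ ∪ {∞}`: the value `-∞` is never attained and the
effective domain is nonempty. -/
def IsProper {E : Type*} (F : E → EReal) : Prop :=
  (∀ x, F x ≠ ⊥) ∧ (effDom F).Nonempty

/-- Convexity of an extended-real-valued functional. Used only for functionals that do not take
the value `-∞`, so that the right-hand side is the usual one (with `0 * ∞ = 0`). -/
def IsConvex {E : Type*} [AddCommGroup E] [Module ℝ E] (F : E → EReal) : Prop :=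
  ∀ x y : E, ∀ t : ℝ, 0 ≤ t → t ≤ 1 →
    F (t • x + (1 - t) • y) ≤ (t : EReal) * F x + ((1 - t : ℝ) : EReal) * F y

section Hilbert

variable {X Y : Type*}
  [NormedAddCommGroup X] [InnerProductSpace ℝ X]
  [NormedAddCommGroup Y] [InnerProductSpace ℝ Y]

/-- The Fenchel conjugate on a Hilbert space (identified with its dual):
`F^*(ξ) = sup_x ⟪ξ, x⟫ - F x`. -/
def conjugate (F : X → EReal) (ξ : X) : EReal :=
  ⨆ x : X, ((inner ℝ ξ x : ℝ) : EReal) - F x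

/-- The convex subdifferential at `x`, as a set of subgradients; it is empty outside the
effective domain. -/
def subdifferential (F : X → EReal) (x : X) : Set X :=
  {ξ | x ∈ effDom F ∧ ∀ x' : X, ((inner ℝ ξ (x' - x) : ℝ) : EReal) ≤ F x' - F x}

/-- The functional `c F`; it is used for `c > 0`. -/
def scale (c : ℝ) (F : X → EReal) : X → EReal := fun x => (c : EReal) * F x

/-- `IsProx F x p` says that `p` is a proximal point of `F` at `x`, i.e. a minimizer over `z` of
`‖z - x‖ ^ 2 / 2 + F z`. -/
def IsProx (F : X → EReal) (x p : X) : Prop :=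
  IsMinOn (fun z : X => ((1 / 2 * ‖z - x‖ ^ 2 : ℝ) : EReal) + F z) Set.univ p

variable [CompleteSpace X] [CompleteSpace Y]

/-- The sequence `z k = (x k, y k)` in the Hilbert space product `X × Y` is generated by the
primal-dual extragradient (Chambolle-Pock) method, started at `z₀`. -/
def IsPrimalDualSeq (F : X → EReal) (G : Y → EReal) (A : X →L[ℝ] Y) (σ τ : ℝ)
    (z₀ : WithLp 2 (X × Y)) (z : ℕ → WithLp 2 (X × Y)) : Prop :=
  z 0 = z₀ ∧ ∀ k : ℕ,
    IsProx (scale τ F) ((z k).fst - τ • A.adjoint (z k).snd) (z (k + 1)).fst ∧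
    IsProx (scale σ (conjugate G))
      ((z k).snd + σ • A ((2 : ℝ) • (z (k + 1)).fst - (z k).fst)) (z (k + 1)).snd

/-- The Fenchel extremality conditions. -/
def FenchelExtremality (F : X → EReal) (G : Y → EReal) (A : X →L[ℝ] Y) (x : X) (y : Y) : Prop :=
  -(A.adjoint y) ∈ subdifferential F x ∧ y ∈ subdifferential G (A x)

end Hilbert

end ConvexOpt

end

/-! Put `T (x, y) = (∂F x + A^* y, ∂G^* y - A x)`. This operator is monotone, as the coupling is
skew, and its zeros are the Fenchel pairs. Dividing the two prox optimality conditions by the step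
sizes turns the iteration into `P (z k - z (k + 1)) ∈ T (z (k + 1))` with `P = (τ⁻¹, -A^*; -A,
σ⁻¹)`. The extrapolation `2 x (k + 1) - x k` is what makes `P` symmetric, and `σ τ ‖A‖ ^ 2 < 1`
makes it coercive (`exists_pos_mul_le_pdForm_self`). The method is thus a proximal point method in
the `P`-norm.

A zero of `T` exists by Fenchel duality (`exists_fenchelExtremality`). Fejér monotonicity towards it
bounds the iterates and sends successive differences to `0`. Monotonicity against an arbitrary point
of the graph passes to weak limits along ultrafilters, and Minty's trick
(`inclusion_of_forall_nonneg`) makes every weak cluster point a zero. The `P`-distances to any two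
zeros converge, so by Opial's argument there is only one cluster point. -/

namespace ConvexOpt

/-! ### Extended-real convexity tested on real upper bounds -/

section Basic

variable {E : Type*}

lemma exists_coe_eq {F : E → EReal} (hF : IsProper F) {x : E} (hx : F x < ⊤) :
    ∃ a : ℝ, F x = a :=
  ⟨(F x).toReal, (EReal.coe_toReal hx.ne (hF.1 x)).symm⟩

lemma le_of_forall_real_le {a b : EReal} (hb : ∀ r : ℝ, b ≤ r → a ≤ r) : a ≤ b :=
  EReal.le_of_forall_lt_iff_le.1 fun r hr => hb r hr.le

variable [AddCommGroup E] [Module ℝ E]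

lemma IsConvex.le_coe {F : E → EReal} (hF : IsConvex F) {x y : E} {a b t : ℝ}
    (hx : F x ≤ a) (hy : F y ≤ b) (h0 : 0 ≤ t) (h1 : t ≤ 1) :
    F (t • x + (1 - t) • y) ≤ ((t * a + (1 - t) * b : ℝ) : EReal) := by
  refine (hF x y t h0 h1).trans ?_
  push_cast
  have h1' : (0 : EReal) ≤ ((1 - t : ℝ) : EReal) := by exact_mod_cast sub_nonneg.2 h1
  have h0' : (0 : EReal) ≤ (t : EReal) := by exact_mod_cast h0
  have := add_le_add (mul_le_mul_of_nonneg_left hx h0') (mul_le_mul_of_nonneg_left hy h1')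
  simpa using this

lemma isConvex_of_le_coe {F : E → EReal} (hbot : ∀ x, F x ≠ ⊥)
    (h : ∀ x y : E, ∀ a b t : ℝ, F x ≤ a → F y ≤ b → 0 < t → t < 1 →
      F (t • x + (1 - t) • y) ≤ ((t * a + (1 - t) * b : ℝ) : EReal)) : IsConvex F := by
  intro x y t h0 h1
  rcases h0.eq_or_lt with rfl | h0
  · simp
  rcases h1.eq_or_lt with rfl | h1
  · simp
  rcases eq_or_ne (F x) ⊤ with hx | hx
  · rw [hx, EReal.coe_mul_top_of_pos h0, EReal.top_add_of_ne_bot]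
    · exact le_top
    · rw [EReal.mul_ne_bot]
      refine ⟨.inl (EReal.coe_ne_bot _), .inr (hbot y), .inl (EReal.coe_ne_top _), .inl ?_⟩
      exact_mod_cast (sub_pos.2 h1).le
  rcases eq_or_ne (F y) ⊤ with hy | hy
  · rw [hy, EReal.coe_mul_top_of_pos (sub_pos.2 h1), EReal.add_top_of_ne_bot]
    · exact le_top
    · rw [EReal.mul_ne_bot]
      refine ⟨.inl (EReal.coe_ne_bot _), .inr (hbot x), .inl (EReal.coe_ne_top _), .inl ?_⟩
      exact_mod_cast h0.le
  have hx' := EReal.coe_toReal hx (hbot x)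
  have hy' := EReal.coe_toReal hy (hbot y)
  have := h x y _ _ t hx'.ge hy'.ge h0 h1
  rw [← hx', ← hy']
  exact_mod_cast this

end Basic

/-! ### Proximal points and subgradients -/

section Prox

variable {X : Type*} [NormedAddCommGroup X] [InnerProductSpace ℝ X] {F : X → EReal}

/-- Replacing `F z` by real bounds `r ≥ F z` keeps the inequality in `ℝ`; points of infinite value
impose no condition. -/
lemma mem_subdifferential_iff (hF : IsProper F) {x ξ : X} :
    ξ ∈ subdifferential F x ↔
      ∃ a : ℝ, F x = a ∧ ∀ (z : X) (r : ℝ), F z ≤ r → inner ℝ ξ (z - x) ≤ r - a := by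
  constructor
  · rintro ⟨hx, h⟩
    obtain ⟨a, ha⟩ := exists_coe_eq hF hx
    refine ⟨a, ha, fun z r hz => ?_⟩
    have := (h z).trans (EReal.sub_le_sub hz ha.ge)
    exact_mod_cast this
  · rintro ⟨a, ha, h⟩
    refine ⟨by simp [effDom, ha], fun z => le_of_forall_real_le fun r hr => ?_⟩
    rw [ha] at hr
    rw [EReal.sub_le_iff_le_add (.inl (EReal.coe_ne_bot _)) (.inl (EReal.coe_ne_top _))] at hr
    have := h z (r + a) (by exact_mod_cast hr)
    rw [add_sub_cancel_right] at this
    exact_mod_cast this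

lemma subdifferential_monotone (hF : IsProper F) {x y ξ η : X} (hx : ξ ∈ subdifferential F x)
    (hy : η ∈ subdifferential F y) : 0 ≤ inner ℝ (ξ - η) (x - y) := by
  obtain ⟨a, ha, h⟩ := (mem_subdifferential_iff hF).1 hx
  obtain ⟨b, hb, k⟩ := (mem_subdifferential_iff hF).1 hy
  have h1 := h y b hb.le
  have h2 := k x a ha.le
  rw [← neg_sub x y, inner_neg_right] at h1
  rw [inner_sub_left]
  linarith

/-- A proper convex lower semicontinuous functional decreases at most linearly. -/
lemma exists_linear_minorant (hF : IsProper F) (hconv : IsConvex F)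
    (hlsc : LowerSemicontinuous F) :
    ∃ (x₀ : X) (a K : ℝ), 0 ≤ K ∧ ∀ (z : X) (r : ℝ), F z ≤ r → a - K * ‖z - x₀‖ ≤ r := by
  obtain ⟨x₀, hx₀⟩ := hF.2
  obtain ⟨a, ha⟩ := exists_coe_eq hF hx₀
  have hlt : ((a - 1 : ℝ) : EReal) < F x₀ := by
    rw [ha]; exact_mod_cast sub_one_lt a
  obtain ⟨δ, hδ, hball⟩ := Metric.eventually_nhds_iff.1 (hlsc x₀ _ hlt)
  refine ⟨x₀, a - 1, 2 / δ, by positivity, fun z r hz => ?_⟩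
  rcases lt_or_ge (dist z x₀) δ with hd | hd
  · have := (hball hd).trans_le hz
    have h1 : a - 1 < r := by exact_mod_cast this
    have : 0 ≤ 2 / δ * ‖z - x₀‖ := by positivity
    linarith
  · rw [dist_eq_norm] at hd
    set d := ‖z - x₀‖ with hdd
    have hdpos : 0 < d := hδ.trans_le hd
    -- This puts the convex combination at distance `δ / 2` from `x₀`, inside the ball where `F > a
    -- - 1`.
    set t := δ / (2 * d) with ht
    have ht0 : 0 < t := by positivity
    have ht1 : t ≤ 1 := by rw [ht, div_le_one (by positivity)]; linarith
    have hw := hconv.le_coe hz ha.le ht0.le ht1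
    have hdist : dist (t • z + (1 - t) • x₀) x₀ < δ := by
      have : t • z + (1 - t) • x₀ - x₀ = t • (z - x₀) := by module
      rw [dist_eq_norm, this, norm_smul, Real.norm_of_nonneg ht0.le, ← hdd, ht]
      field_simp
      linarith
    have h2 := (hball hdist).trans_le hw
    have h3 : a - 1 < t * r + (1 - t) * a := by exact_mod_cast h2
    have h4 : -1 < t * (r - a) := by linarith
    have h5 : -(1 / t) < r - a := by
      rw [neg_lt, ← neg_lt_neg_iff, neg_neg, ← sub_pos]
      have : 0 < (t * (r - a) + 1) / t := div_pos (by linarith) ht0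
      have e : (t * (r - a) + 1) / t = (r - a) + 1 / t := by field_simp
      linarith
    have e : 1 / t = 2 / δ * d := by rw [ht]; field_simp
    linarith

/-- No weak compactness is needed: convexity and the parallelogram law make a minimizing sequence
Cauchy, and lower semicontinuity applies at its strong limit. -/
lemma exists_isProx [CompleteSpace X] (hF : IsProper F) (hconv : IsConvex F)
    (hlsc : LowerSemicontinuous F) (x : X) : ∃ p, IsProx F x p := by
  obtain ⟨x₀, a, K, hK, hmin⟩ := exists_linear_minorant hF hconv hlsc
  let S : Set ℝ := {s | ∃ (z : X) (r : ℝ), F z ≤ r ∧ s = 1 / 2 * ‖z - x‖ ^ 2 + r}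
  have hne : S.Nonempty := by
    obtain ⟨z, hz⟩ := hF.2
    obtain ⟨b, hb⟩ := exists_coe_eq hF hz
    exact ⟨_, z, b, hb.le, rfl⟩
  have hbdd : BddBelow S := by
    -- `-K ^ 2 / 2` is the minimum of `s ^ 2 / 2 - K * s`, with `s = ‖z - x‖`.
    refine ⟨a - K * ‖x - x₀‖ - K ^ 2 / 2, ?_⟩
    rintro s ⟨z, r, hz, rfl⟩
    have h1 := hmin z r hz
    have h2 : ‖z - x₀‖ ≤ ‖z - x‖ + ‖x - x₀‖ := norm_sub_le_norm_sub_add_norm_sub z x x₀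
    have h3 := mul_le_mul_of_nonneg_left h2 hK
    nlinarith [sq_nonneg (‖z - x‖ - K)]
  set m := sInf S with hm
  have hle : ∀ (z : X) (r : ℝ), F z ≤ r → m ≤ 1 / 2 * ‖z - x‖ ^ 2 + r :=
    fun z r hz => csInf_le hbdd ⟨z, r, hz, rfl⟩
  have hseq : ∀ n : ℕ, ∃ (z : X) (r : ℝ), F z ≤ r ∧
      1 / 2 * ‖z - x‖ ^ 2 + r < m + 1 / ((n : ℝ) + 1) := by
    intro n
    obtain ⟨s, ⟨z, r, hz, rfl⟩, hs⟩ := exists_lt_of_csInf_lt hne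
      (show sInf S < m + 1 / ((n : ℝ) + 1) by
        have : (0 : ℝ) < 1 / ((n : ℝ) + 1) := by positivity
        linarith)
    exact ⟨z, r, hz, hs⟩
  choose u r hu hur using hseq
  have hclose : ∀ i j : ℕ,
      ‖u i - u j‖ ^ 2 ≤ 4 * (1 / ((i : ℝ) + 1) + 1 / ((j : ℝ) + 1)) := by
    intro i j
    -- The objective at the midpoint is at least `m`, yet lies `‖u i - u j‖ ^ 2 / 8` below the
    -- average of the bounds at `u i` and `u j`.
    have hmid := hle _ _ (hconv.le_coe (hu i) (hu j) (t := 1 / 2) (by norm_num) (by norm_num))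
    have e : (1 / 2 : ℝ) • u i + (1 - 1 / 2 : ℝ) • u j - x
        = (1 / 2 : ℝ) • ((u i - x) + (u j - x)) := by module
    have hpar := parallelogram_law_with_norm ℝ (u i - x) (u j - x)
    rw [sub_sub_sub_cancel_right] at hpar
    rw [e, norm_smul, Real.norm_of_nonneg (by norm_num)] at hmid
    have := hur i
    have := hur j
    nlinarith
  have hlim : Tendsto (fun n : ℕ => 1 / ((n : ℝ) + 1)) atTop (𝓝 0) :=
    tendsto_one_div_add_atTop_nhds_zero_nat
  have hcauchy : CauchySeq u := by
    refine Metric.cauchySeq_iff.2 fun ε hε => ?_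
    obtain ⟨N, hN⟩ := eventually_atTop.1 (hlim.eventually_lt_const (show 0 < ε ^ 2 / 8 by positivity))
    refine ⟨N, fun i hi j hj => ?_⟩
    have h1 := hN i hi
    have h2 := hN j hj
    have h3 := hclose i j
    rw [dist_eq_norm]
    exact lt_of_pow_lt_pow_left₀ 2 hε.le (by linarith)
  obtain ⟨p, hp⟩ := cauchySeq_tendsto_of_complete hcauchy
  have hnorm : Tendsto (fun n : ℕ => m + 1 / ((n : ℝ) + 1) - 1 / 2 * ‖u n - x‖ ^ 2) atTop
      (𝓝 (m + 0 - 1 / 2 * ‖p - x‖ ^ 2)) :=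
    (hlim.const_add m).sub (((hp.sub_const x).norm.pow 2).const_mul _)
  rw [add_zero] at hnorm
  have hval : F p ≤ ((m - 1 / 2 * ‖p - x‖ ^ 2 : ℝ) : EReal) := by
    refine EReal.ge_of_forall_gt_iff_ge.1 fun c hc => ?_
    have hev := hp.eventually (hlsc p c hc)
    have : ∀ᶠ n : ℕ in atTop, c ≤ m + 1 / ((n : ℝ) + 1) - 1 / 2 * ‖u n - x‖ ^ 2 := by
      filter_upwards [hev] with n hn
      have h1 : c < r n := by exact_mod_cast hn.trans_le (hu n)
      have h2 := hur n
      linarith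
    exact_mod_cast ge_of_tendsto hnorm this
  refine ⟨p, isMinOn_univ_iff.2 fun z => ?_⟩
  have h1 : ((1 / 2 * ‖p - x‖ ^ 2 : ℝ) : EReal) + F p ≤ (m : EReal) := by
    have := add_le_add (le_refl ((1 / 2 * ‖p - x‖ ^ 2 : ℝ) : EReal)) hval
    refine this.trans (le_of_eq ?_)
    rw [← EReal.coe_add]
    congr 1
    ring
  refine h1.trans ?_
  rcases eq_or_ne (F z) ⊤ with hz | hz
  · rw [hz, EReal.coe_add_top]
    exact le_top
  · have hz' := EReal.coe_toReal hz (hF.1 z)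
    have := hle z _ hz'.ge
    rw [← hz']
    exact_mod_cast this

/-- Compare `p` with `t • z + (1 - t) • p`, divide by `t` and let `t` tend to `0`. -/
lemma IsProx.sub_mem_subdifferential (hF : IsProper F) (hconv : IsConvex F) {x p : X}
    (hp : IsProx F x p) : x - p ∈ subdifferential F p := by
  have hmin := isMinOn_univ_iff.1 hp
  have hreal : ∀ (z : X) (r : ℝ), F z ≤ r →
      ((1 / 2 * ‖p - x‖ ^ 2 : ℝ) : EReal) + F p ≤ ((1 / 2 * ‖z - x‖ ^ 2 + r : ℝ) : EReal) := by
    intro z r hz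
    refine (hmin z).trans ?_
    rw [EReal.coe_add]
    exact add_le_add le_rfl hz
  have hfin : F p < ⊤ := by
    obtain ⟨z, hz⟩ := hF.2
    obtain ⟨b, hb⟩ := exists_coe_eq hF hz
    have := hreal z b hb.le
    by_contra! h
    rw [top_le_iff.1 h, EReal.coe_add_top, top_le_iff] at this
    exact EReal.coe_ne_top _ this
  obtain ⟨a, ha⟩ := exists_coe_eq hF hfin
  refine (mem_subdifferential_iff hF).2 ⟨a, ha, fun z r hz => ?_⟩
  have key : ∀ t : ℝ, 0 < t → t ≤ 1 →
      inner ℝ (x - p) (z - p) ≤ r - a + t * (1 / 2 * ‖z - p‖ ^ 2) := by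
    intro t h0 h1
    have h := hreal _ _ (hconv.le_coe hz ha.le h0.le h1)
    rw [ha] at h
    have h' : 1 / 2 * ‖p - x‖ ^ 2 + a ≤
        1 / 2 * ‖t • z + (1 - t) • p - x‖ ^ 2 + (t * r + (1 - t) * a) := by exact_mod_cast h
    have e : t • z + (1 - t) • p - x = t • (z - p) - (x - p) := by module
    rw [e, norm_sub_rev p x, norm_sub_sq_real (t • (z - p)), norm_smul,
      Real.norm_of_nonneg h0.le, real_inner_smul_left, real_inner_comm] at h'
    have h2 : t * inner ℝ (x - p) (z - p) ≤ t * (r - a + t * (1 / 2 * ‖z - p‖ ^ 2)) := by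
      nlinarith
    exact le_of_mul_le_mul_left h2 h0
  have hlim : Tendsto (fun t : ℝ => r - a + t * (1 / 2 * ‖z - p‖ ^ 2)) (𝓝[>] 0)
      (𝓝 (r - a + 0 * (1 / 2 * ‖z - p‖ ^ 2))) :=
    ((tendsto_id.mul_const _).const_add _).mono_left nhdsWithin_le_nhds
  rw [zero_mul, add_zero] at hlim
  refine ge_of_tendsto hlim ?_
  filter_upwards [Ioc_mem_nhdsGT (zero_lt_one' ℝ)] with t ht using key t ht.1 ht.2

lemma eq_of_sub_mem_subdifferential (hF : IsProper F) {x p q : X}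
    (hp : x - p ∈ subdifferential F p) (hq : x - q ∈ subdifferential F q) : p = q := by
  have h := subdifferential_monotone hF hp hq
  have e : x - p - (x - q) = -(p - q) := by abel
  rw [e, inner_neg_left, real_inner_self_eq_norm_sq] at h
  have : ‖p - q‖ = 0 := by nlinarith [sq_nonneg ‖p - q‖]
  exact sub_eq_zero.1 (norm_eq_zero.1 this)

lemma existsUnique_isProx [CompleteSpace X] (hF : IsProper F) (hconv : IsConvex F)
    (hlsc : LowerSemicontinuous F) (x : X) : ∃! p, IsProx F x p := by
  obtain ⟨p, hp⟩ := exists_isProx hF hconv hlsc x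
  exact ⟨p, hp, fun q hq => eq_of_sub_mem_subdifferential hF
    (hq.sub_mem_subdifferential hF hconv) (hp.sub_mem_subdifferential hF hconv)⟩

/-- Minty surjectivity of `1 + ∂F`. -/
lemma exists_sub_mem_subdifferential [CompleteSpace X] (hF : IsProper F) (hconv : IsConvex F)
    (hlsc : LowerSemicontinuous F) (x : X) : ∃ p, x - p ∈ subdifferential F p :=
  (exists_isProx hF hconv hlsc x).imp fun _ hp => hp.sub_mem_subdifferential hF hconv

end Prox

/-! ### Positive multiples of a functional -/

section Scale

variable {X : Type*} {F : X → EReal} {c : ℝ}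

lemma scale_le_iff (hc : 0 < c) {x : X} {a : ℝ} : scale c F x ≤ a ↔ F x ≤ ((a / c : ℝ) : EReal) := by
  rw [scale, EReal.coe_div, EReal.le_div_iff_mul_le (by exact_mod_cast hc) (EReal.coe_ne_top _),
    mul_comm]

lemma IsProper.scale (hF : IsProper F) (hc : 0 < c) : IsProper (scale c F) := by
  refine ⟨fun x => ?_, ?_⟩
  · rw [ConvexOpt.scale, EReal.mul_ne_bot]
    refine ⟨.inl (EReal.coe_ne_bot _), .inr (hF.1 x), .inl (EReal.coe_ne_top _), .inl ?_⟩
    exact_mod_cast hc.le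
  · obtain ⟨x, hx⟩ := hF.2
    obtain ⟨a, ha⟩ := exists_coe_eq hF hx
    refine ⟨x, lt_of_le_of_lt ((scale_le_iff hc (a := c * a)).2 ?_) (EReal.coe_lt_top _)⟩
    rw [mul_div_cancel_left₀ _ hc.ne', ha]

lemma IsConvex.scale [AddCommGroup X] [Module ℝ X] (hF : IsProper F) (hconv : IsConvex F)
    (hc : 0 < c) : IsConvex (scale c F) := by
  refine isConvex_of_le_coe (hF.scale hc).1 fun x y a b t hx hy h0 h1 => ?_
  rw [scale_le_iff hc] at hx hy ⊢
  convert hconv.le_coe hx hy h0.le h1.le using 2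
  ring

lemma lowerSemicontinuous_scale [TopologicalSpace X] (hlsc : LowerSemicontinuous F)
    (hc : 0 < c) : LowerSemicontinuous (scale c F) := by
  have hcont : Continuous fun y : EReal => (c : EReal) * y := by
    refine continuous_iff_continuousAt.2 fun y => EReal.Tendsto.const_mul tendsto_id ?_ ?_
    · exact .inl (EReal.coe_ne_bot _)
    · exact .inl (EReal.coe_ne_top _)
  exact hcont.comp_lowerSemicontinuous hlsc
    fun _ _ h => mul_le_mul_of_nonneg_left h (by exact_mod_cast hc.le)

lemma mem_subdifferential_of_scale [NormedAddCommGroup X] [InnerProductSpace ℝ X]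
    (hF : IsProper F) (hc : 0 < c) {x ξ : X} (h : ξ ∈ subdifferential (scale c F) x) :
    c⁻¹ • ξ ∈ subdifferential F x := by
  obtain ⟨a, ha, h⟩ := (mem_subdifferential_iff (hF.scale hc)).1 h
  have hxa := (scale_le_iff hc).1 ha.le
  obtain ⟨b, hb⟩ := exists_coe_eq hF (hxa.trans_lt (EReal.coe_lt_top _))
  have hab : a = c * b := by
    have : scale c F x = ((c * b : ℝ) : EReal) := by simp [scale, hb]
    exact_mod_cast ha.symm.trans this
  refine (mem_subdifferential_iff hF).2 ⟨b, hb, fun z r hz => ?_⟩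
  have := h z (c * r) ((scale_le_iff hc).2 (by rwa [mul_div_cancel_left₀ _ hc.ne']))
  rw [real_inner_smul_left, inv_mul_le_iff₀ hc]
  linarith

end Scale

/-! ### Fenchel conjugates -/

section Conjugate

variable {X : Type*} [NormedAddCommGroup X] [InnerProductSpace ℝ X] {F : X → EReal}

lemma conjugate_le_iff (hF : IsProper F) {ξ : X} {a : ℝ} :
    conjugate F ξ ≤ a ↔ ∀ (x : X) (b : ℝ), F x ≤ b → inner ℝ ξ x - b ≤ a := by
  rw [conjugate, iSup_le_iff]
  refine forall_congr' fun x => ⟨fun h b hb => ?_, fun h => ?_⟩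
  · exact_mod_cast (EReal.sub_le_sub le_rfl hb).trans h
  · rcases eq_or_ne (F x) ⊤ with hx | hx
    · simp [hx]
    · have hx' := EReal.coe_toReal hx (hF.1 x)
      have := h _ hx'.ge
      rw [← hx']
      exact_mod_cast this

/-- Equality case of Fenchel-Young: the subgradient inequality says that `x` attains the supremum.
-/
lemma conjugate_eq_of_mem_subdifferential (hF : IsProper F) {x ξ : X} {a : ℝ} (ha : F x = a)
    (h : ξ ∈ subdifferential F x) : conjugate F ξ = ((inner ℝ ξ x - a : ℝ) : EReal) := by
  refine le_antisymm ((conjugate_le_iff hF).2 fun z b hz => ?_) ?_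
  · obtain ⟨a', ha', h⟩ := (mem_subdifferential_iff hF).1 h
    have e : a = a' := by exact_mod_cast ha.symm.trans ha'
    have := h z b hz
    rw [inner_sub_right] at this
    linarith
  · refine le_trans (le_of_eq ?_) (le_iSup (fun z => ((inner ℝ ξ z : ℝ) : EReal) - F z) x)
    simp [ha]

lemma conjugate_ne_bot (hF : IsProper F) (ξ : X) : conjugate F ξ ≠ ⊥ := by
  obtain ⟨x, hx⟩ := hF.2
  obtain ⟨a, ha⟩ := exists_coe_eq hF hx
  refine ne_bot_of_le_ne_bot ?_ (le_iSup (fun z => ((inner ℝ ξ z : ℝ) : EReal) - F z) x)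
  simp only [ha]
  exact EReal.coe_ne_bot (_ - _)

/-- The conjugate is finite at any subgradient, and the proximal point of `0` supplies one. -/
lemma isProper_conjugate [CompleteSpace X] (hF : IsProper F) (hconv : IsConvex F)
    (hlsc : LowerSemicontinuous F) : IsProper (conjugate F) := by
  refine ⟨conjugate_ne_bot hF, ?_⟩
  obtain ⟨p, hp⟩ := exists_sub_mem_subdifferential hF hconv hlsc 0
  obtain ⟨a, ha, -⟩ := (mem_subdifferential_iff hF).1 hp
  refine ⟨0 - p, ?_⟩
  rw [effDom, Set.mem_ofPred_eq, conjugate_eq_of_mem_subdifferential hF ha hp]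
  exact EReal.coe_lt_top _

lemma isConvex_conjugate (hF : IsProper F) : IsConvex (conjugate F) := by
  refine isConvex_of_le_coe (conjugate_ne_bot hF) fun ξ η a b t ha hb h0 h1 => ?_
  rw [conjugate_le_iff hF] at ha hb ⊢
  intro x r hr
  have h2 := mul_le_mul_of_nonneg_left (ha x r hr) h0.le
  have h3 := mul_le_mul_of_nonneg_left (hb x r hr) (sub_nonneg.2 h1.le)
  rw [inner_add_left, real_inner_smul_left, real_inner_smul_left]
  linarith

lemma lowerSemicontinuous_conjugate (hF : IsProper F) : LowerSemicontinuous (conjugate F) := by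
  refine lowerSemicontinuous_iSup fun x => Continuous.lowerSemicontinuous ?_
  rcases eq_or_ne (F x) ⊤ with hx | hx
  · simpa [hx] using continuous_const
  · rw [← EReal.coe_toReal hx (hF.1 x)]
    have : Continuous fun ξ : X => inner ℝ ξ x - (F x).toReal := by fun_prop
    exact continuous_coe_real_ereal.comp this

lemma mem_subdifferential_conjugate (hF : IsProper F) (hF' : IsProper (conjugate F)) {x ξ : X}
    (h : ξ ∈ subdifferential F x) : x ∈ subdifferential (conjugate F) ξ := by
  obtain ⟨a, ha, -⟩ := (mem_subdifferential_iff hF).1 h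
  refine (mem_subdifferential_iff hF').2
    ⟨_, conjugate_eq_of_mem_subdifferential hF ha h, fun η r hr => ?_⟩
  have := (conjugate_le_iff hF).1 hr x a ha.le
  rw [inner_sub_right, real_inner_comm η x, real_inner_comm ξ x]
  linarith

/-- The subdifferentials of a functional and of its conjugate are inverse to each other. -/
lemma mem_subdifferential_conjugate_iff [CompleteSpace X] (hF : IsProper F) (hconv : IsConvex F)
    (hlsc : LowerSemicontinuous F) {x ξ : X} :
    x ∈ subdifferential (conjugate F) ξ ↔ ξ ∈ subdifferential F x := by
  have hF' := isProper_conjugate hF hconv hlsc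
  refine ⟨fun h => ?_, mem_subdifferential_conjugate hF hF'⟩
  -- Maximality replaces biconjugation: `p` lies in `∂F^*` at `x + ξ - p`, and monotonicity of
  -- `∂F^*` against `h` gives `-‖p - x‖ ^ 2 ≥ 0`.
  obtain ⟨p, hp⟩ := exists_sub_mem_subdifferential hF hconv hlsc (x + ξ)
  have hmono := subdifferential_monotone hF' (mem_subdifferential_conjugate hF hF' hp) h
  have e : x + ξ - p - ξ = -(p - x) := by abel
  rw [e, inner_neg_right, real_inner_self_eq_norm_sq] at hmono
  have h0 : ‖p - x‖ = 0 := by nlinarith [sq_nonneg ‖p - x‖]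
  obtain rfl := sub_eq_zero.1 (norm_eq_zero.1 h0)
  rwa [add_sub_cancel_left] at hp

end Conjugate

/-! ### Fenchel duality by separation -/

section Duality

variable {X Y : Type*}
  [NormedAddCommGroup X] [InnerProductSpace ℝ X]
  [NormedAddCommGroup Y] [InnerProductSpace ℝ Y]

/-- By Baire's theorem, a lower semicontinuous functional is bounded above on some nonempty open
subset of its effective domain if the latter has an interior point. -/
lemma exists_eventually_le_of_interior_effDom {Y : Type*} [TopologicalSpace Y] [BaireSpace Y]
    {G : Y → EReal} (hlsc : LowerSemicontinuous G) (hne : (interior (effDom G)).Nonempty) :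
    ∃ (w : Y) (n : ℕ), ∀ᶠ v in 𝓝 w, G v ≤ ((n : ℝ) : EReal) := by
  -- Adding the complement of the interior makes these closed sets cover the whole space, as Baire's
  -- theorem requires.
  let S : ℕ → Set Y := fun n => {w | G w ≤ ((n : ℝ) : EReal)} ∪ (interior (effDom G))ᶜ
  have hclosed : ∀ n, IsClosed (S n) := fun n =>
    (hlsc.isClosed_preimage _).union isOpen_interior.isClosed_compl
  have hcover : ⋃ n, S n = Set.univ := by
    refine Set.eq_univ_of_forall fun w => Set.mem_iUnion.2 ?_
    by_cases hw : w ∈ interior (effDom G)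
    · obtain ⟨r, hr, -⟩ := EReal.lt_iff_exists_real_btwn.1
        (show w ∈ effDom G from interior_subset hw)
      obtain ⟨n, hn⟩ := exists_nat_ge r
      exact ⟨n, .inl (hr.le.trans (by exact_mod_cast hn))⟩
    · exact ⟨0, .inr hw⟩
  obtain ⟨w, hw, hwS⟩ := (dense_iUnion_interior_of_closed hclosed hcover).inter_open_nonempty _
    isOpen_interior hne
  obtain ⟨n, hn⟩ := Set.mem_iUnion.1 hwS
  refine ⟨w, n, ?_⟩
  filter_upwards [isOpen_interior.mem_nhds hw, isOpen_interior.mem_nhds hn] with v hv hvn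
  exact (interior_subset hvn).resolve_right fun h => h hv

/-- The epigraph of the value function of the perturbed problems
`min_x F x + G (A x + v)`. -/
def perturbationEpigraph (F : X → EReal) (G : Y → EReal) (A : X →L[ℝ] Y) : Set (Y × ℝ) :=
  {p | ∃ (x : X) (a b : ℝ), F x ≤ a ∧ G (A x + p.1) ≤ b ∧ a + b ≤ p.2}

variable {F : X → EReal} {G : Y → EReal} {A : X →L[ℝ] Y}

lemma convex_perturbationEpigraph (hF : IsConvex F) (hG : IsConvex G) :
    Convex ℝ (perturbationEpigraph F G A) := by
  rintro ⟨v, r⟩ ⟨x, a, b, hx, hv, hr⟩ ⟨w, s⟩ ⟨y, c, d, hy, hw, hs⟩ t t' ht ht' htt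
  obtain rfl : t' = 1 - t := by linarith
  refine ⟨t • x + (1 - t) • y, t * a + (1 - t) * c, t * b + (1 - t) * d,
    hF.le_coe hx hy ht (by linarith), ?_, ?_⟩
  · convert hG.le_coe hv hw ht (by linarith) using 2
    simp only [map_add, map_smul, Prod.fst_add, Prod.smul_fst]
    module
  · simp only [Prod.snd_add, Prod.smul_snd, smul_eq_mul] at *
    have := mul_le_mul_of_nonneg_left hr ht
    have := mul_le_mul_of_nonneg_left hs ht'
    linarith

/-- Fenchel duality: under the interior point condition, a solution of the primal problem is
part of a pair satisfying the extremality conditions. -/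
theorem exists_fenchelExtremality [CompleteSpace X] [CompleteSpace Y]
    (hF : IsProper F) (hFconv : IsConvex F)
    (hG : IsProper G) (hGconv : IsConvex G) (hGlsc : LowerSemicontinuous G)
    {x₀ : X} (hx₀ : x₀ ∈ effDom F) (hAx₀ : A x₀ ∈ interior (effDom G))
    {x : X} (hx : IsMinOn (fun x => F x + G (A x)) Set.univ x) :
    ∃ y : Y, FenchelExtremality F G A x y := by
  obtain ⟨a₀, ha₀⟩ := exists_coe_eq hF hx₀
  obtain ⟨b₀, hb₀⟩ := exists_coe_eq hG (show A x₀ ∈ effDom G from interior_subset hAx₀)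
  have hmin := isMinOn_univ_iff.1 hx
  have hreal : ∀ (z : X) (a b : ℝ), F z ≤ a → G (A z) ≤ b →
      F x + G (A x) ≤ ((a + b : ℝ) : EReal) := fun z a b ha hb =>
    (hmin z).trans (add_le_add ha hb)
  have hfin : F x + G (A x) ≠ ⊤ :=
    ((hreal x₀ a₀ b₀ ha₀.le hb₀.le).trans_lt (EReal.coe_lt_top _)).ne
  rw [EReal.add_ne_top_iff_ne_top₂ (hF.1 _) (hG.1 _)] at hfin
  obtain ⟨a, ha⟩ := exists_coe_eq hF hfin.1.lt_top
  obtain ⟨b, hb⟩ := exists_coe_eq hG hfin.2.lt_top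
  have hle : ∀ (z : X) (c d : ℝ), F z ≤ c → G (A z) ≤ d → a + b ≤ c + d := by
    intro z c d hc hd
    have := hreal z c d hc hd
    rw [ha, hb] at this
    exact_mod_cast this
  -- At perturbation `0` the optimal value is `a + b`, so no point `(0, a + b - ε)` lies in the
  -- epigraph.
  have hnot : ((0 : Y), a + b) ∉ interior (perturbationEpigraph F G A) := by
    intro h
    have hcont : Tendsto (fun ε : ℝ => ((0 : Y), a + b - ε)) (𝓝[>] 0) (𝓝 ((0 : Y), a + b)) := by
      have : Continuous fun ε : ℝ => ((0 : Y), a + b - ε) := by fun_prop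
      simpa using (this.tendsto 0).mono_left nhdsWithin_le_nhds
    obtain ⟨ε, hε, hpos⟩ := ((hcont.eventually (mem_interior_iff_mem_nhds.1 h)).and
      self_mem_nhdsWithin).exists
    obtain ⟨z, c, d, hc, hd, hcd⟩ := hε
    rw [add_zero] at hd
    have := hle z c d hc hd
    have : (0 : ℝ) < ε := hpos
    simp only at hcd
    linarith
  obtain ⟨w, n, hw⟩ := exists_eventually_le_of_interior_effDom hGlsc ⟨_, hAx₀⟩
  have hint : (interior (perturbationEpigraph F G A)).Nonempty := by
    refine ⟨(w - A x₀, a₀ + n + 1), mem_interior_iff_mem_nhds.2 ?_⟩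
    have h1 : Tendsto (fun p : Y × ℝ => A x₀ + p.1) (𝓝 (w - A x₀, a₀ + n + 1)) (𝓝 w) := by
      have : Continuous fun p : Y × ℝ => A x₀ + p.1 := by fun_prop
      simpa using this.tendsto (w - A x₀, a₀ + n + 1)
    have h2 : ∀ᶠ p : Y × ℝ in 𝓝 (w - A x₀, a₀ + n + 1), a₀ + n < p.2 :=
      continuous_snd.continuousAt.eventually_const_lt (lt_add_one _)
    filter_upwards [h1.eventually hw, h2] with p hp1 hp2
    exact ⟨x₀, a₀, n, ha₀.le, hp1, hp2.le⟩
  obtain ⟨f, hf0, hf⟩ := geometric_hahn_banach_of_nonempty_interior_point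
    (convex_perturbationEpigraph hFconv hGconv) hnot hint
  set g : Y →L[ℝ] ℝ := f.comp (ContinuousLinearMap.inl ℝ Y ℝ) with hg
  set κ : ℝ := f (0, 1) with hκ
  have hsplit : ∀ (v : Y) (s : ℝ), f (v, s) = g v + s * κ := by
    intro v s
    have : ((v, s) : Y × ℝ) = (v, 0) + s • ((0 : Y), (1 : ℝ)) := by simp
    rw [this, map_add, map_smul]
    simp [hg, hκ]
  have hkey : ∀ (z : X) (v : Y) (c d s : ℝ), F z ≤ c → G (A z + v) ≤ d → c + d ≤ s →
      g v + s * κ ≤ (a + b) * κ := by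
    intro z v c d s hc hd hs
    have := hf (v, s) ⟨z, c, d, hc, hd, hs⟩
    rwa [hsplit, hsplit, map_zero, zero_add] at this
  -- The epigraph is unbounded upwards.
  have hκ0 : κ ≤ 0 := by
    have := hkey x 0 a b (a + b + 1) ha.le (by rw [add_zero, hb]) (by linarith)
    rw [map_zero] at this
    linarith
  -- A vertical hyperplane is excluded by the interior point: `g` would have a local maximum at `0`,
  -- hence vanish, and so would `f`.
  have hκne : κ ≠ 0 := by
    intro h0
    refine hf0 (ContinuousLinearMap.ext fun p => ?_)
    have hmax : IsLocalMax g 0 := by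
      have h1 : Tendsto (fun v : Y => A x₀ + v) (𝓝 0) (𝓝 (A x₀)) := by
        have : Continuous fun v : Y => A x₀ + v := by fun_prop
        simpa using this.tendsto 0
      filter_upwards [h1.eventually (mem_interior_iff_mem_nhds.1 hAx₀)] with v hv
      obtain ⟨d, hd⟩ := exists_coe_eq hG hv
      have := hkey x₀ v a₀ d _ ha₀.le hd.le le_rfl
      simpa [h0] using this
    have hg0 : g = 0 := hmax.hasFDerivAt_eq_zero g.hasFDerivAt
    rw [show p = (p.1, p.2) from rfl, hsplit, hg0, h0]
    simp
  have hκneg : κ < 0 := lt_of_le_of_ne hκ0 hκne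
  set u : Y := (InnerProductSpace.toDual ℝ Y).symm g with hu
  have hug : ∀ v, inner ℝ u v = g v := fun v => InnerProductSpace.toDual_symm_apply
  have hineq : ∀ (z : X) (v : Y) (c d : ℝ), F z ≤ c → G v ≤ d →
      inner ℝ ((-κ)⁻¹ • u) (v - A z) ≤ (c + d) - (a + b) := by
    intro z v c d hc hd
    have := hkey z (v - A z) c d _ hc (by rwa [add_sub_cancel]) le_rfl
    rw [real_inner_smul_left, hug, inv_mul_le_iff₀ (neg_pos.2 hκneg)]
    linarith
  -- The dual solution is the slope of the supporting hyperplane. Fixing `v = A x` in `hineq` yields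
  -- the condition on `F`, fixing `z = x` the one on `G`.
  refine ⟨(-κ)⁻¹ • u, (mem_subdifferential_iff hF).2 ⟨a, ha, fun z r hz => ?_⟩,
    (mem_subdifferential_iff hG).2 ⟨b, hb, fun v r hv => ?_⟩⟩
  · have := hineq z (A x) r b hz hb.le
    rw [inner_neg_left, ContinuousLinearMap.adjoint_inner_left, map_sub, ← inner_neg_right,
      neg_sub]
    linarith
  · have := hineq x v a r ha.le hv
    linarith

end Duality

/-- Bounded sequences in a Hilbert space converge weakly along ultrafilters. -/
lemma exists_tendsto_inner_of_norm_le {H ι : Type*} [NormedAddCommGroup H]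
    [InnerProductSpace ℝ H] [CompleteSpace H] (U : Ultrafilter ι) {u : ι → H} {R : ℝ}
    (hu : ∀ i, ‖u i‖ ≤ R) :
    ∃ x : H, ∀ h : H, Tendsto (fun i => inner ℝ h (u i)) U (𝓝 (inner ℝ h x)) := by
  let w : ι → WeakDual ℝ H := fun i => StrongDual.toWeakDual (InnerProductSpace.toDual ℝ H (u i))
  have hmem : ∀ i, w i ∈ WeakDual.toStrongDual ⁻¹' Metric.closedBall (0 : StrongDual ℝ H) R := by
    intro i
    rw [Set.mem_preimage, mem_closedBall_zero_iff]
    exact ((InnerProductSpace.toDual ℝ H).norm_map (u i)).le.trans (hu i)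
  obtain ⟨f, -, hf⟩ := (WeakDual.isCompact_closedBall (𝕜 := ℝ) (E := H) 0 R).ultrafilter_le_nhds'
    (U.map w) (Ultrafilter.mem_map.2 (univ_mem' hmem))
  have hf' : Tendsto w U (𝓝 f) := hf
  refine ⟨(InnerProductSpace.toDual ℝ H).symm (WeakDual.toStrongDual f), fun h => ?_⟩
  have := tendsto_iff_forall_eval_tendsto_topDualPairing.1 hf' h
  rw [real_inner_comm, InnerProductSpace.toDual_symm_apply]
  refine this.congr fun i => ?_
  rw [real_inner_comm]
  rfl

/-! ### The bilinear form of the preconditioner -/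

section Form

variable {X Y : Type*}
  [NormedAddCommGroup X] [InnerProductSpace ℝ X]
  [NormedAddCommGroup Y] [InnerProductSpace ℝ Y]

/-- The bilinear form of the preconditioner `(α, -A^*; -A, β)` of the primal-dual method. -/
def pdForm (α β : ℝ) (A : X →L[ℝ] Y) (x : X) (y : Y) (u : X) (v : Y) : ℝ :=
  α * inner ℝ x u + β * inner ℝ y v - inner ℝ (A x) v - inner ℝ (A u) y

variable {α β : ℝ} {A : X →L[ℝ] Y}

lemma pdForm_sub_left (x₁ x₂ u : X) (y₁ y₂ v : Y) :
    pdForm α β A (x₁ - x₂) (y₁ - y₂) u v = pdForm α β A x₁ y₁ u v - pdForm α β A x₂ y₂ u v := by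
  simp only [pdForm, map_sub, inner_sub_left, inner_sub_right]
  ring

lemma pdForm_add_right (x u₁ u₂ : X) (y v₁ v₂ : Y) :
    pdForm α β A x y (u₁ + u₂) (v₁ + v₂) = pdForm α β A x y u₁ v₁ + pdForm α β A x y u₂ v₂ := by
  simp only [pdForm, map_add, inner_add_left, inner_add_right]
  ring

lemma pdForm_self_add (x u : X) (y v : Y) :
    pdForm α β A (x + u) (y + v) (x + u) (y + v) =
      pdForm α β A x y x y + 2 * pdForm α β A x y u v + pdForm α β A u v u v := by
  simp only [pdForm, map_add, inner_add_left, inner_add_right, real_inner_comm x u,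
    real_inner_comm y v]
  ring

lemma pdForm_self_sub (x u : X) (y v : Y) :
    pdForm α β A (x - u) (y - v) (x - u) (y - v) =
      pdForm α β A x y x y - 2 * pdForm α β A x y u v + pdForm α β A u v u v := by
  simp only [pdForm, map_sub, inner_sub_left, inner_sub_right, real_inner_comm x u,
    real_inner_comm y v]
  ring

lemma exists_pos_mul_le_pdForm_self (hα : 0 < α) (hβ : 0 < β) (h : ‖A‖ ^ 2 < α * β) :
    ∃ c : ℝ, 0 < c ∧ ∀ (x : X) (y : Y), c * (‖x‖ ^ 2 + ‖y‖ ^ 2) ≤ pdForm α β A x y x y := by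
  -- Determinant over trace of `(α, -‖A‖; -‖A‖, β)`, a lower bound for its smaller eigenvalue: `(α -
  -- c) * (β - c) = ‖A‖ ^ 2 + c ^ 2`.
  set c := (α * β - ‖A‖ ^ 2) / (α + β) with hc
  have hcpos : 0 < c := div_pos (by linarith) (by linarith)
  have hcα : 0 < α - c := by
    rw [sub_pos, hc, div_lt_iff₀ (by linarith)]
    nlinarith [sq_nonneg ‖A‖]
  have hprod : ‖A‖ ^ 2 ≤ (α - c) * (β - c) := by
    have : c * (α + β) = α * β - ‖A‖ ^ 2 := div_mul_cancel₀ _ (by linarith)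
    nlinarith [sq_nonneg c]
  refine ⟨c, hcpos, fun x y => ?_⟩
  have h1 : inner ℝ (A x) y ≤ ‖A‖ * ‖x‖ * ‖y‖ :=
    (real_inner_le_norm _ _).trans
      (mul_le_mul_of_nonneg_right (A.le_opNorm x) (norm_nonneg y))
  have h2 : 2 * (‖A‖ * ‖x‖ * ‖y‖) ≤ (α - c) * ‖x‖ ^ 2 + (β - c) * ‖y‖ ^ 2 := by
    have h3 : 0 ≤ ((α - c) * (β - c) - ‖A‖ ^ 2) * ‖y‖ ^ 2 :=
      mul_nonneg (by linarith) (sq_nonneg _)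
    have h4 : (α - c) * (2 * (‖A‖ * ‖x‖ * ‖y‖)) ≤
        (α - c) * ((α - c) * ‖x‖ ^ 2 + (β - c) * ‖y‖ ^ 2) := by
      linarith [sq_nonneg ((α - c) * ‖x‖ - ‖A‖ * ‖y‖)]
    exact le_of_mul_le_mul_left h4 hcα
  simp only [pdForm, real_inner_self_eq_norm_sq]
  linarith

lemma eq_and_eq_of_pdForm_nonpos {c : ℝ} (hc : 0 < c)
    (hcoer : ∀ (x : X) (y : Y), c * (‖x‖ ^ 2 + ‖y‖ ^ 2) ≤ pdForm α β A x y x y)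
    {x₁ x₂ : X} {y₁ y₂ : Y}
    (h : pdForm α β A (x₁ - x₂) (y₁ - y₂) (x₁ - x₂) (y₁ - y₂) ≤ 0) : x₁ = x₂ ∧ y₁ = y₂ := by
  have h1 := (hcoer _ _).trans h
  have h2 : ‖x₁ - x₂‖ ^ 2 + ‖y₁ - y₂‖ ^ 2 ≤ 0 := by
    by_contra! h3
    exact absurd h1 (not_le.2 (mul_pos hc h3))
  have h3 : ‖x₁ - x₂‖ ^ 2 = 0 := by nlinarith [sq_nonneg ‖x₁ - x₂‖, sq_nonneg ‖y₁ - y₂‖]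
  have h4 : ‖y₁ - y₂‖ ^ 2 = 0 := by nlinarith [sq_nonneg ‖x₁ - x₂‖, sq_nonneg ‖y₁ - y₂‖]
  exact ⟨sub_eq_zero.1 (norm_eq_zero.1 (pow_eq_zero_iff two_ne_zero |>.1 h3)),
    sub_eq_zero.1 (norm_eq_zero.1 (pow_eq_zero_iff two_ne_zero |>.1 h4))⟩

/-- With the second argument fixed, the form is a weakly continuous functional of the first; the
adjoint moves `A` off the varying point. -/
lemma tendsto_pdForm {ι : Type*} {l : Filter ι} {x : ι → X} {y : ι → Y} {x' : X} {y' : Y}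
    [CompleteSpace X] [CompleteSpace Y]
    (hx : ∀ h : X, Tendsto (fun i => inner ℝ h (x i)) l (𝓝 (inner ℝ h x')))
    (hy : ∀ h : Y, Tendsto (fun i => inner ℝ h (y i)) l (𝓝 (inner ℝ h y'))) (u : X) (v : Y) :
    Tendsto (fun i => pdForm α β A (x i) (y i) u v) l (𝓝 (pdForm α β A x' y' u v)) := by
  have e : ∀ (p : X) (q : Y), pdForm α β A p q u v =
      α * inner ℝ u p + β * inner ℝ v q - inner ℝ (A.adjoint v) p - inner ℝ (A u) q := by
    intro p q
    rw [pdForm, real_inner_comm u p, real_inner_comm v q, ContinuousLinearMap.adjoint_inner_left,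
      real_inner_comm v (A p)]
  simp only [e]
  exact ((((hx u).const_mul α).add ((hy v).const_mul β)).sub (hx _)).sub (hy _)

end Form

/-! ### Weak convergence of the preconditioned proximal point method -/

section Convergence

variable {X Y : Type*}
  [NormedAddCommGroup X] [InnerProductSpace ℝ X] [CompleteSpace X]
  [NormedAddCommGroup Y] [InnerProductSpace ℝ Y] [CompleteSpace Y]

/-- Monotonicity of a set-valued operator on a Hilbert space. -/
def IsMonotoneOp {H : Type*} [NormedAddCommGroup H] [InnerProductSpace ℝ H]
    (M : H → Set H) : Prop :=
  ∀ ⦃x y ξ η : H⦄, ξ ∈ M x → η ∈ M y → 0 ≤ inner ℝ (ξ - η) (x - y)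

/-- The iterates `(x k, y k)` of the preconditioned proximal point method for the monotone
inclusion `-A^* y ∈ M x`, `A x ∈ N y`. -/
def IsPreconditionedProxSeq (α β : ℝ) (A : X →L[ℝ] Y) (M : X → Set X) (N : Y → Set Y)
    (x : ℕ → X) (y : ℕ → Y) : Prop :=
  ∀ k, α • (x k - x (k + 1)) - A.adjoint (y k) ∈ M (x (k + 1)) ∧
    β • (y k - y (k + 1)) + A ((2 : ℝ) • x (k + 1) - x k) ∈ N (y (k + 1))

variable {α β : ℝ} {A : X →L[ℝ] Y} {M : X → Set X} {N : Y → Set Y} {x : ℕ → X} {y : ℕ → Y}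

/-- Monotonicity of the coupled operator between an iterate and a graph point. The coupling is skew,
so its quadratic terms cancel: the bracket is affine in the iterate and passes to weak limits. -/
lemma IsPreconditionedProxSeq.nonneg (hM : IsMonotoneOp M) (hN : IsMonotoneOp N)
    (hz : IsPreconditionedProxSeq α β A M N x y) {u ξ : X} {v η : Y} (hξ : ξ ∈ M u) (hη : η ∈ N v)
    (k : ℕ) :
    0 ≤ pdForm α β A (x k - x (k + 1)) (y k - y (k + 1)) (x (k + 1) - u) (y (k + 1) - v) +
      (-inner ℝ ξ (x (k + 1) - u) - inner ℝ η (y (k + 1) - v) + inner ℝ (A u) (y (k + 1))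
        - inner ℝ (A.adjoint v) (x (k + 1))) := by
  have h1 := hM (hz k).1 hξ
  have h2 := hN (hz k).2 hη
  have e : ∀ (p : Y) (q : X), inner ℝ (A.adjoint p) q = inner ℝ (A q) p := fun p q => by
    rw [ContinuousLinearMap.adjoint_inner_left, real_inner_comm]
  simp only [pdForm, e, map_sub, map_smul, inner_sub_left, inner_sub_right, inner_add_left,
    real_inner_smul_left] at h1 h2 ⊢
  linarith

/-- At a solution the bracket of `IsPreconditionedProxSeq.nonneg` vanishes. -/
lemma IsPreconditionedProxSeq.pdForm_nonneg (hM : IsMonotoneOp M) (hN : IsMonotoneOp N)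
    (hz : IsPreconditionedProxSeq α β A M N x y) {u : X} {v : Y} (hu : -A.adjoint v ∈ M u)
    (hv : A u ∈ N v) (k : ℕ) :
    0 ≤ pdForm α β A (x k - x (k + 1)) (y k - y (k + 1)) (x (k + 1) - u) (y (k + 1) - v) := by
  have h := hz.nonneg hM hN hu hv k
  have e : inner ℝ (A.adjoint v) u = inner ℝ (A u) v := by
    rw [ContinuousLinearMap.adjoint_inner_left, real_inner_comm]
  simp only [inner_neg_left, inner_sub_right, e] at h
  linarith

/-- Fejér monotonicity with respect to the form of the preconditioner. -/
lemma IsPreconditionedProxSeq.fejer (hM : IsMonotoneOp M) (hN : IsMonotoneOp N)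
    (hz : IsPreconditionedProxSeq α β A M N x y) {u : X} {v : Y} (hu : -A.adjoint v ∈ M u)
    (hv : A u ∈ N v) (k : ℕ) :
    pdForm α β A (x (k + 1) - u) (y (k + 1) - v) (x (k + 1) - u) (y (k + 1) - v) +
        pdForm α β A (x k - x (k + 1)) (y k - y (k + 1)) (x k - x (k + 1)) (y k - y (k + 1)) ≤
      pdForm α β A (x k - u) (y k - v) (x k - u) (y k - v) := by
  have h := hz.pdForm_nonneg hM hN hu hv k
  have e := pdForm_self_add (α := α) (β := β) (A := A) (x k - x (k + 1)) (x (k + 1) - u)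
    (y k - y (k + 1)) (y (k + 1) - v)
  rw [sub_add_sub_cancel, sub_add_sub_cancel] at e
  linarith

/-- Minty's trick: a point that is monotonically related to the graph of the operator is a
solution of the inclusion. -/
lemma inclusion_of_forall_nonneg (hMs : ∀ x, ∃ p, x - p ∈ M p) (hNs : ∀ y, ∃ p, y - p ∈ N p)
    {x' : X} {y' : Y}
    (h : ∀ ⦃u ξ : X⦄ ⦃v η : Y⦄, ξ ∈ M u → η ∈ N v →
      0 ≤ -inner ℝ ξ (x' - u) - inner ℝ η (y' - v) + inner ℝ (A u) y'
        - inner ℝ (A.adjoint v) x') :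
    -A.adjoint y' ∈ M x' ∧ A x' ∈ N y' := by
  -- Tested at these two separate resolvents, the hypothesis collapses to `-‖x' - u‖ ^ 2 - ‖y' - v‖
  -- ^ 2 ≥ 0`, again by skewness.
  obtain ⟨u, hu⟩ := hMs (x' - A.adjoint y')
  obtain ⟨v, hv⟩ := hNs (y' + A x')
  have h1 := h hu hv
  have e : ∀ (p : Y) (q : X), inner ℝ (A.adjoint p) q = inner ℝ (A q) p := fun p q => by
    rw [ContinuousLinearMap.adjoint_inner_left, real_inner_comm]
  have e1 : x' - A.adjoint y' - u = (x' - u) - A.adjoint y' := by abel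
  have e2 : y' + A x' - v = (y' - v) + A x' := by abel
  rw [e1, e2, inner_sub_left, inner_add_left, real_inner_self_eq_norm_sq,
    real_inner_self_eq_norm_sq, e, e, map_sub, inner_sub_left, inner_sub_right] at h1
  have h3 : ‖x' - u‖ ^ 2 = 0 := by nlinarith [sq_nonneg ‖x' - u‖, sq_nonneg ‖y' - v‖]
  have h4 : ‖y' - v‖ ^ 2 = 0 := by nlinarith [sq_nonneg ‖x' - u‖, sq_nonneg ‖y' - v‖]
  obtain rfl := sub_eq_zero.1 (norm_eq_zero.1 (pow_eq_zero_iff two_ne_zero |>.1 h3))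
  obtain rfl := sub_eq_zero.1 (norm_eq_zero.1 (pow_eq_zero_iff two_ne_zero |>.1 h4))
  rw [e1, sub_self, zero_sub] at hu
  rw [e2, sub_self, zero_add] at hv
  exact ⟨hu, hv⟩

/-- Weak convergence of the preconditioned proximal point method. -/
theorem IsPreconditionedProxSeq.exists_weak_limit (hα : 0 < α) (hβ : 0 < β)
    (hA : ‖A‖ ^ 2 < α * β) (hM : IsMonotoneOp M) (hN : IsMonotoneOp N)
    (hMs : ∀ x, ∃ p, x - p ∈ M p) (hNs : ∀ y, ∃ p, y - p ∈ N p)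
    (hz : IsPreconditionedProxSeq α β A M N x y)
    (hsol : ∃ (u : X) (v : Y), -A.adjoint v ∈ M u ∧ A u ∈ N v) :
    ∃ (x' : X) (y' : Y), -A.adjoint y' ∈ M x' ∧ A x' ∈ N y' ∧
      (∀ h : X, Tendsto (fun k => inner ℝ h (x k)) atTop (𝓝 (inner ℝ h x'))) ∧
      (∀ h : Y, Tendsto (fun k => inner ℝ h (y k)) atTop (𝓝 (inner ℝ h y'))) := by
  obtain ⟨c, hc, hcoer⟩ := exists_pos_mul_le_pdForm_self hα hβ hA
  have hQ : ∀ (p : X) (q : Y), 0 ≤ pdForm α β A p q p q := fun p q =>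
    le_trans (by positivity) (hcoer p q)
  have hanti : ∀ {u : X} {v : Y}, -A.adjoint v ∈ M u → A u ∈ N v →
      Antitone fun k => pdForm α β A (x k - u) (y k - v) (x k - u) (y k - v) :=
    fun hu hv => antitone_nat_of_succ_le fun k => by
      have := hz.fejer hM hN hu hv k
      have := hQ (x k - x (k + 1)) (y k - y (k + 1))
      linarith
  have hconv : ∀ {u : X} {v : Y}, -A.adjoint v ∈ M u → A u ∈ N v → ∃ ℓ : ℝ,
      Tendsto (fun k => pdForm α β A (x k - u) (y k - v) (x k - u) (y k - v)) atTop (𝓝 ℓ) :=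
    fun hu hv => ⟨_, tendsto_atTop_ciInf (hanti hu hv)
      ⟨0, by rintro _ ⟨k, rfl⟩; exact hQ _ _⟩⟩
  obtain ⟨u₀, v₀, hu₀, hv₀⟩ := hsol
  obtain ⟨ℓ, hℓ⟩ := hconv hu₀ hv₀
  have hdiff : Tendsto (fun k => pdForm α β A (x k - u₀) (y k - v₀) (x k - u₀) (y k - v₀) -
      pdForm α β A (x (k + 1) - u₀) (y (k + 1) - v₀) (x (k + 1) - u₀) (y (k + 1) - v₀))
      atTop (𝓝 0) := by
    simpa using hℓ.sub (hℓ.comp (tendsto_add_atTop_nat 1))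
  have hd : Tendsto (fun k => pdForm α β A (x k - x (k + 1)) (y k - y (k + 1))
      (x k - x (k + 1)) (y k - y (k + 1))) atTop (𝓝 0) :=
    squeeze_zero (fun k => hQ _ _)
      (fun k => by have := hz.fejer hM hN hu₀ hv₀ k; linarith) hdiff
  have hsq : Tendsto (fun k => c⁻¹ * pdForm α β A (x k - x (k + 1)) (y k - y (k + 1))
      (x k - x (k + 1)) (y k - y (k + 1))) atTop (𝓝 0) := by
    simpa using hd.const_mul c⁻¹
  have hle : ∀ (p : X) (q : Y), ‖p‖ ^ 2 + ‖q‖ ^ 2 ≤ c⁻¹ * pdForm α β A p q p q := fun p q => by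
    rw [← div_eq_inv_mul, le_div_iff₀ hc, mul_comm]
    exact hcoer p q
  have hdx : Tendsto (fun k => x k - x (k + 1)) atTop (𝓝 0) := by
    rw [tendsto_zero_iff_norm_tendsto_zero]
    have := (squeeze_zero (fun k => sq_nonneg ‖x k - x (k + 1)‖) (fun k =>
      le_trans (le_add_of_nonneg_right (sq_nonneg _)) (hle _ (y k - y (k + 1)))) hsq).sqrt
    simpa using this
  have hdy : Tendsto (fun k => y k - y (k + 1)) atTop (𝓝 0) := by
    rw [tendsto_zero_iff_norm_tendsto_zero]
    have := (squeeze_zero (fun k => sq_nonneg ‖y k - y (k + 1)‖) (fun k =>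
      le_trans (le_add_of_nonneg_left (sq_nonneg _)) (hle (x k - x (k + 1)) _)) hsq).sqrt
    simpa using this
  have hdx' : ∀ h : X, Tendsto (fun k => inner ℝ h (x k - x (k + 1))) atTop (𝓝 (inner ℝ h 0)) :=
    fun h => tendsto_const_nhds.inner hdx
  have hdy' : ∀ h : Y, Tendsto (fun k => inner ℝ h (y k - y (k + 1))) atTop (𝓝 (inner ℝ h 0)) :=
    fun h => tendsto_const_nhds.inner hdy
  -- boundedness
  set R := Real.sqrt (c⁻¹ * pdForm α β A (x 0 - u₀) (y 0 - v₀) (x 0 - u₀) (y 0 - v₀)) with hR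
  have hbound : ∀ k, ‖x k - u₀‖ ^ 2 + ‖y k - v₀‖ ^ 2 ≤
      c⁻¹ * pdForm α β A (x 0 - u₀) (y 0 - v₀) (x 0 - u₀) (y 0 - v₀) := fun k =>
    (hle _ _).trans (mul_le_mul_of_nonneg_left (hanti hu₀ hv₀ (Nat.zero_le k))
      (inv_nonneg.2 hc.le))
  have hbx : ∀ k, ‖x k‖ ≤ R + ‖u₀‖ := fun k => by
    have h1 : ‖x k - u₀‖ ≤ R :=
      Real.le_sqrt_of_sq_le (by nlinarith [hbound k, sq_nonneg ‖y k - v₀‖])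
    have h2 := norm_le_norm_sub_add (x k) u₀
    linarith
  have hby : ∀ k, ‖y k‖ ≤ R + ‖v₀‖ := fun k => by
    have h1 : ‖y k - v₀‖ ≤ R :=
      Real.le_sqrt_of_sq_le (by nlinarith [hbound k, sq_nonneg ‖x k - u₀‖])
    have h2 := norm_le_norm_sub_add (y k) v₀
    linarith
  -- weak cluster points solve the inclusion
  have hcluster : ∀ U : Ultrafilter ℕ, (U : Filter ℕ) ≤ atTop → ∃ (x' : X) (y' : Y),
      (-A.adjoint y' ∈ M x' ∧ A x' ∈ N y') ∧
      (∀ h : X, Tendsto (fun k => inner ℝ h (x k)) U (𝓝 (inner ℝ h x'))) ∧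
      (∀ h : Y, Tendsto (fun k => inner ℝ h (y k)) U (𝓝 (inner ℝ h y'))) := by
    intro U hU
    obtain ⟨x', hx'⟩ := exists_tendsto_inner_of_norm_le U hbx
    obtain ⟨y', hy'⟩ := exists_tendsto_inner_of_norm_le U hby
    refine ⟨x', y', inclusion_of_forall_nonneg hMs hNs fun u ξ v η hξ hη => ?_, hx', hy'⟩
    have hx1 : ∀ h : X, Tendsto (fun k => inner ℝ h (x (k + 1))) U (𝓝 (inner ℝ h x')) := fun h => by
      have := (hx' h).sub ((hdx' h).mono_left hU)
      simpa only [inner_sub_right, sub_sub_cancel, inner_zero_right, sub_zero] using this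
    have hy1 : ∀ h : Y, Tendsto (fun k => inner ℝ h (y (k + 1))) U (𝓝 (inner ℝ h y')) := fun h => by
      have := (hy' h).sub ((hdy' h).mono_left hU)
      simpa only [inner_sub_right, sub_sub_cancel, inner_zero_right, sub_zero] using this
    -- For the known solution `(u₀, v₀)`, polarization writes the form as half of the Fejér decrease
    -- minus the squared step. Passing to `(u, v)` adds a term with fixed second argument, which
    -- vanishes with the differences.
    have hform : Tendsto (fun k => pdForm α β A (x k - x (k + 1)) (y k - y (k + 1))
        (x (k + 1) - u) (y (k + 1) - v)) atTop (𝓝 0) := by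
      have h1 := ((hdiff.sub hd).div_const 2).add
        (tendsto_pdForm (α := α) (β := β) (A := A) hdx' hdy' (u₀ - u) (v₀ - v))
      have e0 : (0 - 0) / 2 + pdForm α β A (0 : X) (0 : Y) (u₀ - u) (v₀ - v) = 0 := by
        simp [pdForm]
      rw [e0] at h1
      refine h1.congr fun k => ?_
      have e1 := pdForm_self_add (α := α) (β := β) (A := A) (x k - x (k + 1)) (x (k + 1) - u₀)
        (y k - y (k + 1)) (y (k + 1) - v₀)
      have e2 := pdForm_add_right (α := α) (β := β) (A := A) (x k - x (k + 1))
        (x (k + 1) - u₀) (u₀ - u) (y k - y (k + 1)) (y (k + 1) - v₀) (v₀ - v)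
      simp only [sub_add_sub_cancel] at e1 e2
      linarith
    have hlim : Tendsto (fun k => pdForm α β A (x k - x (k + 1)) (y k - y (k + 1))
        (x (k + 1) - u) (y (k + 1) - v) +
        (-inner ℝ ξ (x (k + 1) - u) - inner ℝ η (y (k + 1) - v) + inner ℝ (A u) (y (k + 1))
          - inner ℝ (A.adjoint v) (x (k + 1)))) U
        (𝓝 (0 + (-inner ℝ ξ (x' - u) - inner ℝ η (y' - v) + inner ℝ (A u) y'
          - inner ℝ (A.adjoint v) x'))) := by
      simp only [inner_sub_right ξ, inner_sub_right η]
      exact (hform.mono_left hU).add ((((((hx1 ξ).sub_const _).neg).sub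
        ((hy1 η).sub_const _)).add (hy1 _)).sub (hx1 _))
    rw [zero_add] at hlim
    exact ge_of_tendsto hlim (Eventually.of_forall fun k => hz.nonneg hM hN hξ hη k)
  -- uniqueness of weak cluster points
  obtain ⟨x', y', hs', hx', hy'⟩ := hcluster (Ultrafilter.of atTop) (Ultrafilter.of_le _)
  have huniq : ∀ U : Ultrafilter ℕ, (U : Filter ℕ) ≤ atTop →
      (∀ h : X, Tendsto (fun k => inner ℝ h (x k)) U (𝓝 (inner ℝ h x'))) ∧
      (∀ h : Y, Tendsto (fun k => inner ℝ h (y k)) U (𝓝 (inner ℝ h y'))) := by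
    intro U hU
    obtain ⟨x₁, y₁, hs₁, hx₁, hy₁⟩ := hcluster U hU
    obtain ⟨ℓ', hℓ'⟩ := hconv hs'.1 hs'.2
    obtain ⟨ℓ₁, hℓ₁⟩ := hconv hs₁.1 hs₁.2
    -- Opial's argument: in the difference of the squared distances to both cluster points the
    -- quadratic terms in the iterate cancel, so this pairing converges along `atTop`. Its limits
    -- along the two ultrafilters must therefore agree.
    have hlim : Tendsto (fun k => pdForm α β A (x k) (y k) (x' - x₁) (y' - y₁)) atTop
        (𝓝 ((ℓ₁ - ℓ' + (pdForm α β A x' y' x' y' - pdForm α β A x₁ y₁ x₁ y₁)) / 2)) := by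
      refine (((hℓ₁.sub hℓ').add_const _).div_const 2).congr fun k => ?_
      have e1 := pdForm_self_sub (α := α) (β := β) (A := A) (x k) x₁ (y k) y₁
      have e2 := pdForm_self_sub (α := α) (β := β) (A := A) (x k) x' (y k) y'
      have e3 := pdForm_add_right (α := α) (β := β) (A := A) (x k) (x' - x₁) x₁ (y k) (y' - y₁) y₁
      simp only [sub_add_cancel] at e3
      linarith
    have h1 := tendsto_nhds_unique (hlim.mono_left (Ultrafilter.of_le atTop))
      (tendsto_pdForm hx' hy' _ _)
    have h2 := tendsto_nhds_unique (hlim.mono_left hU) (tendsto_pdForm hx₁ hy₁ _ _)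
    have h3 : pdForm α β A (x' - x₁) (y' - y₁) (x' - x₁) (y' - y₁) ≤ 0 := by
      rw [pdForm_sub_left, ← h1, ← h2, sub_self]
    obtain ⟨rfl, rfl⟩ := eq_and_eq_of_pdForm_nonpos hc hcoer h3
    exact ⟨hx₁, hy₁⟩
  exact ⟨x', y', hs'.1, hs'.2,
    fun h => (tendsto_iff_ultrafilter _ _ _).2 fun U hU => (huniq U hU).1 h,
    fun h => (tendsto_iff_ultrafilter _ _ _).2 fun U hU => (huniq U hU).2 h⟩

end Convergence

/-! ### The primal-dual method as a preconditioned proximal point method -/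

section PrimalDual

variable {X Y : Type*}
  [NormedAddCommGroup X] [InnerProductSpace ℝ X] [CompleteSpace X]
  [NormedAddCommGroup Y] [InnerProductSpace ℝ Y] [CompleteSpace Y]
  {F : X → EReal} {G : Y → EReal} {A : X →L[ℝ] Y} {σ τ : ℝ} {z₀ : WithLp 2 (X × Y)}

lemma existsUnique_isPrimalDualSeq
    (hprimal : ∀ x, ∃! p, IsProx (scale τ F) x p)
    (hdual : ∀ y, ∃! q, IsProx (scale σ (conjugate G)) y q) :
    ∃! z, IsPrimalDualSeq F G A σ τ z₀ z := by
  choose P hP hPu using hprimal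
  choose Q hQ hQu using hdual
  let step : WithLp 2 (X × Y) → WithLp 2 (X × Y) := fun w =>
    WithLp.toLp 2 (P (w.fst - τ • A.adjoint w.snd),
      Q (w.snd + σ • A ((2 : ℝ) • P (w.fst - τ • A.adjoint w.snd) - w.fst)))
  refine ⟨fun k => step^[k] z₀, ⟨rfl, fun k => ?_⟩, fun w hw => ?_⟩
  · simp only [Function.iterate_succ_apply']
    exact ⟨hP _, hQ _⟩
  · funext k
    induction k with
    | zero => exact hw.1
    | succ k ih =>
      obtain ⟨h1, h2⟩ := hw.2 k
      have e1 := hPu _ _ h1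
      have e2 := hQu _ _ h2
      simp only [Function.iterate_succ_apply']
      rw [← ih]
      refine WithLp.ofLp_injective 2 (Prod.ext e1 ?_)
      rw [e1] at e2
      exact e2

lemma IsPrimalDualSeq.isPreconditionedProxSeq (hF : IsProper F) (hFconv : IsConvex F)
    (hG' : IsProper (conjugate G)) (hG'conv : IsConvex (conjugate G))
    (hσ : 0 < σ) (hτ : 0 < τ) {z : ℕ → WithLp 2 (X × Y)} (hz : IsPrimalDualSeq F G A σ τ z₀ z) :
    IsPreconditionedProxSeq τ⁻¹ σ⁻¹ A (subdifferential F) (subdifferential (conjugate G))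
      (fun k => (z k).fst) (fun k => (z k).snd) := by
  intro k
  obtain ⟨h1, h2⟩ := hz.2 k
  have k1 := mem_subdifferential_of_scale hF hτ
    (h1.sub_mem_subdifferential (hF.scale hτ) (hFconv.scale hF hτ))
  have k2 := mem_subdifferential_of_scale hG' hσ
    (h2.sub_mem_subdifferential (hG'.scale hσ) (hG'conv.scale hG' hσ))
  constructor
  · convert k1 using 1
    rw [sub_right_comm, smul_sub τ⁻¹ _ (τ • _), inv_smul_smul₀ hτ.ne']
  · convert k2 using 1
    rw [add_sub_right_comm, smul_add σ⁻¹ _ (σ • _), inv_smul_smul₀ hσ.ne']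

/-- By Riesz, every functional on the Hilbert product is a sum of one inner product in each factor.
-/
lemma tendsto_toWeakSpace_prod {ι : Type*} {l : Filter ι} {z : ι → WithLp 2 (X × Y)} {x : X} {y : Y}
    (hx : ∀ h : X, Tendsto (fun k => inner ℝ h (z k).fst) l (𝓝 (inner ℝ h x)))
    (hy : ∀ h : Y, Tendsto (fun k => inner ℝ h (z k).snd) l (𝓝 (inner ℝ h y))) :
    Tendsto (fun k => toWeakSpace ℝ (WithLp 2 (X × Y)) (z k)) l
      (𝓝 (toWeakSpace ℝ (WithLp 2 (X × Y)) (WithLp.toLp 2 (x, y)))) := by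
  have hinj : Function.Injective (topDualPairing ℝ (WithLp 2 (X × Y))).flip := by
    intro a b hab
    refine ext_inner_left ℝ fun v => ?_
    exact LinearMap.congr_fun hab (InnerProductSpace.toDual ℝ _ v)
  refine (WeakBilin.tendsto_iff_forall_eval_tendsto _ hinj).2 fun f => ?_
  have e : ∀ w : WithLp 2 (X × Y), f w =
      inner ℝ ((InnerProductSpace.toDual ℝ _).symm f).fst w.fst +
        inner ℝ ((InnerProductSpace.toDual ℝ _).symm f).snd w.snd := fun w => by
    rw [← InnerProductSpace.toDual_symm_apply, WithLp.prod_inner_apply]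
    rfl
  have h := (hx ((InnerProductSpace.toDual ℝ _).symm f).fst).add
    (hy ((InnerProductSpace.toDual ℝ _).symm f).snd)
  have e' : f (WithLp.toLp 2 (x, y)) =
      inner ℝ ((InnerProductSpace.toDual ℝ _).symm f).fst x +
        inner ℝ ((InnerProductSpace.toDual ℝ _).symm f).snd y := e _
  rw [← e'] at h
  exact h.congr fun k => (e (z k)).symm

end PrimalDual

end ConvexOpt

theorem mainTheorem9 {X Y : Type*}
    [NormedAddCommGroup X] [InnerProductSpace ℝ X] [CompleteSpace X]
    [NormedAddCommGroup Y] [InnerProductSpace ℝ Y] [CompleteSpace Y]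
    (F : X → EReal) (G : Y → EReal) (A : X →L[ℝ] Y)
    (hF : ConvexOpt.IsProper F) (hFconv : ConvexOpt.IsConvex F) (hFlsc : LowerSemicontinuous F)
    (hG : ConvexOpt.IsProper G) (hGconv : ConvexOpt.IsConvex G) (hGlsc : LowerSemicontinuous G)
    (hsol : ∃ x : X, IsMinOn (fun x => F x + G (A x)) Set.univ x)
    (hqual : ∃ x₀ : X, x₀ ∈ ConvexOpt.effDom F ∩ ConvexOpt.effDom (G ∘ A) ∧
      A x₀ ∈ interior (ConvexOpt.effDom G))
    (σ τ : ℝ) (hσ : 0 < σ) (hτ : 0 < τ) (hστ : σ * τ * ‖A‖ ^ 2 < 1)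
    (z₀ : WithLp 2 (X × Y)) :
    (∃! z : ℕ → WithLp 2 (X × Y), ConvexOpt.IsPrimalDualSeq F G A σ τ z₀ z) ∧
    ∀ z : ℕ → WithLp 2 (X × Y), ConvexOpt.IsPrimalDualSeq F G A σ τ z₀ z →
      ∃ (x : X) (y : Y),
        Tendsto (fun k => toWeakSpace ℝ (WithLp 2 (X × Y)) (z k)) atTop
          (𝓝 (toWeakSpace ℝ (WithLp 2 (X × Y)) (WithLp.toLp 2 (x, y)))) ∧
        ConvexOpt.FenchelExtremality F G A x y ∧
        A x ∈ ConvexOpt.subdifferential (ConvexOpt.conjugate G) y := by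
  have hG' := ConvexOpt.isProper_conjugate hG hGconv hGlsc
  have hG'conv := ConvexOpt.isConvex_conjugate hG
  have hG'lsc := ConvexOpt.lowerSemicontinuous_conjugate hG
  refine ⟨ConvexOpt.existsUnique_isPrimalDualSeq
    (ConvexOpt.existsUnique_isProx (hF.scale hτ) (hFconv.scale hF hτ)
      (ConvexOpt.lowerSemicontinuous_scale hFlsc hτ))
    (ConvexOpt.existsUnique_isProx (hG'.scale hσ) (hG'conv.scale hG' hσ)
      (ConvexOpt.lowerSemicontinuous_scale hG'lsc hσ)), fun z hz => ?_⟩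
  obtain ⟨x₀, hx₀, hAx₀⟩ := hqual
  obtain ⟨u, hu⟩ := hsol
  -- The qualification condition is needed only here, to turn the primal solution into a zero of the
  -- coupled operator.
  obtain ⟨v, huv, hvu⟩ :=
    ConvexOpt.exists_fenchelExtremality hF hFconv hG hGconv hGlsc hx₀.1 hAx₀ hu
  have hA : ‖A‖ ^ 2 < τ⁻¹ * σ⁻¹ := by
    rw [← mul_inv, ← one_div, lt_div_iff₀ (by positivity)]
    linarith
  obtain ⟨x, y, hxy, hyx, hx, hy⟩ :=
    (hz.isPreconditionedProxSeq hF hFconv hG' hG'conv hσ hτ).exists_weak_limit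
      (inv_pos.2 hτ) (inv_pos.2 hσ) hA
      (fun _ _ _ _ h h' => ConvexOpt.subdifferential_monotone hF h h')
      (fun _ _ _ _ h h' => ConvexOpt.subdifferential_monotone hG' h h')
      (ConvexOpt.exists_sub_mem_subdifferential hF hFconv hFlsc)
      (ConvexOpt.exists_sub_mem_subdifferential hG' hG'conv hG'lsc)
      ⟨u, v, huv, ConvexOpt.mem_subdifferential_conjugate hG hG' hvu⟩
  exact ⟨x, y, ConvexOpt.tendsto_toWeakSpace_prod hx hy,
    ⟨hxy, (ConvexOpt.mem_subdifferential_conjugate_iff hG hGconv hGlsc).1 hyx⟩, hyx⟩
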